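/- Let $X$ be a finite set. Let $X^*$ be the rooted tree of finite words over $X$ (root the empty word, the children of a word $w$ being the words $wx$, $x\in X$), and let $X^{-\omega}$ be the space of left-infinite words $\ldots x_2x_1$ with the product topology ($X$ discrete). Let $\sigma(\ldots x_2x_1)=\ldots x_3x_2$. A faithful action of a group $G$ on $X^*$ by automorphisms of the rooted tree is \emph{self-similar} if for all $g\in G$, $x\in X$ there are $h\in G$, $y\in X$ with $g(xw)=y\,h(w)$ for all $w\in X^*$. Then for every $v\in X^*$ there is a unique $g|_v\in G$ with $g(vw)=g(v)\,g|_v(w)$ for all $w$. The action is \emph{contracting} if there is a finite $N\subset G$ such that for every $g\in G$ there is $k$ with $g|_v\in N$ whenever $|v|\ge k$. Its \emph{limit space} $\mathcal J_G$, with quotient map $p:X^{-\omega}\to\mathcal J_G$, is the quotient of $X^{-\omega}$ by the equivalence relation: $\ldots x_2x_1\sim\ldots y_2y_1$ iff there is a sequence $(g_k)_{k\ge1}$ in $G$ taking only finitely many values with $g_k(x_k\ldots x_1)=y_k\ldots y_1$ for all $k$. A \emph{self-similar structure} $\mathcal L=(K,X,\{F_i\}_{i\in X})$ consists of a compact metrizable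 space $K$ and continuous injections $F_i:K\to K$ for which there is a (necessarily unique) continuous surjection $\pi:X^{-\omega}\to K$ with $F_i(\pi(\ldots x_2x_1))=\pi(\ldots x_2x_1i)$ for all $i\in X$. Its cells are $K_w=F_{x_1}\circ F_{x_2}\circ\cdots\circ F_{x_n}(K)$ for $w=x_n\ldots x_2x_1$. It is \emph{finitely ramified} if $K_w\cap K_v$ is finite for all distinct words $w\ne v$ of the same length, and \emph{p.c.f.} if $\mathcal P=\bigcup_{n\ge1}\sigma^n(\mathcal C)$ is finite, where $\mathcal C=\pi^{-1}\big(\bigcup_{i\ne j}K_i\cap K_j\big)$. Structures on $K_1$, $K_2$ with finite alphabets $X_1$, $X_2$ and surjections $\pi_1$, $\pi_2$ are \emph{isomorphic} if there is a bijection $\rho:X_1\to X_2$ such that $\pi_1(\ldots x_2x_1)\mapsto\pi_2(\ldots\rho(x_2)\rho(x_1))$ is a well-defined homeomorphism $K_1\to K_2$. \emph{The self-similar structure on the limit space} $\mathcal J_G$ of a contracting action is the self-similar structure on $\mathcal J_G$ whose surjection $\pi$ is $p$, when it exists. \textbf{Corollary.} Let $\mathcal L$ be the self-similar structure on the limit space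 $\mathcal J_G$ of a contracting action of a group $G$ on $X^*$. Then $\mathcal L$ is p.c.f. if and only if it is finitely ramified. Consequently, a self-similar structure (with finite alphabet) that is finitely ramified but not p.c.f. is not isomorphic to the self-similar structure on the limit space of any contracting action. -/

import Mathlib

namespace LimitSpaces

universe u v w u' w'

/-! ### Words over an alphabet -/

/-- The rooted tree of finite words over `X`. A word `x_n ... x_2 x_1` is the list
`[x_n, ..., x_2, x_1]` (leftmost letter first); the root is the empty word, and the children of a
word `s` are the words `s x` with `x` a letter. -/
def wordTree (X : Type u) : SimpleGraph (List X) where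
  Adj s t := (∃ x, t = s ++ [x]) ∨ (∃ x, s = t ++ [x])
  symm := ⟨fun _ _ h => h.symm⟩
  loopless := ⟨fun s h => by
    rcases h with ⟨x, hx⟩ | ⟨x, hx⟩ <;> simpa using congrArg List.length hx⟩

/-- Left-infinite words `... x_3 x_2 x_1` over `X`; the value at `n` is the letter `x_{n+1}`. -/
def LeftWord (X : Type u) : Type u := ℕ → X

/-- The product topology on left-infinite words, each factor `X` being discrete. -/
instance LeftWord.instTopologicalSpace (X : Type u) : TopologicalSpace (LeftWord X) :=
  @Pi.topologicalSpace ℕ (fun _ => X) (fun _ => ⊥)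

/-- The finite word `x_k ... x_2 x_1` formed by the last `k` letters of `... x_2 x_1`. -/
def LeftWord.last {X : Type u} (ξ : LeftWord X) : ℕ → List X
  | 0 => []
  | k + 1 => ξ k :: LeftWord.last ξ k

/-- The map `... x_2 x_1 ↦ ... x_2 x_1 i`. -/
def LeftWord.snoc {X : Type u} (i : X) (ξ : LeftWord X) : LeftWord X
  | 0 => i
  | n + 1 => ξ n

/-- The shift map `... x_3 x_2 x_1 ↦ ... x_3 x_2`. -/
def LeftWord.shift {X : Type u} (ξ : LeftWord X) : LeftWord X := fun n => ξ (n + 1)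

/-- The letterwise image of a left-infinite word. -/
def LeftWord.map {X : Type u} {Y : Type u'} (ρ : X → Y) (ξ : LeftWord X) : LeftWord Y :=
  fun n => ρ (ξ n)

/-! ### Self-similar and contracting actions -/

/-- A self-similar action of `G` on the tree of words over `X`: a faithful action by automorphisms
of the rooted tree such that for all `g` and `x` there are `h` and `y` with `g (x w) = y h(w)` for
every word `w`. -/
structure IsSelfSimilarAction (G : Type v) (X : Type u) [Group G] [MulAction G (List X)] :
    Prop where
  faithful : FaithfulSMul G (List X)
  smul_root : ∀ g : G, g • ([] : List X) = []
  adj_iff : ∀ (g : G) (s t : List X), (wordTree X).Adj (g • s) (g • t) ↔ (wordTree X).Adj s t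
  stateClosed : ∀ (g : G) (x : X), ∃ (h : G) (y : X), ∀ w : List X, g • (x :: w) = y :: (h • w)

/-- `h` is the restriction `g|_s` of `g` at the word `s`, i.e. `g (s w) = g(s) h(w)` for every
word `w`. For a self-similar action there is exactly one such `h`. -/
def IsRestriction {G : Type v} {X : Type u} [Group G] [MulAction G (List X)]
    (g : G) (s : List X) (h : G) : Prop :=
  ∀ w : List X, g • (s ++ w) = (g • s) ++ (h • w)

/-- A contracting action: a self-similar action for which there is a finite set `N` such that every
`g` has all its restrictions at sufficiently long words in `N`. -/
structure IsContractingAction (G : Type v) (X : Type u) [Group G] [MulAction G (List X)] : Prop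
    extends IsSelfSimilarAction G X where
  contracting : ∃ N : Set G, N.Finite ∧ ∀ g : G, ∃ k : ℕ, ∀ s : List X, k ≤ s.length →
    ∃ h ∈ N, IsRestriction g s h

/-! ### The limit space -/

/-- Asymptotic equivalence of `... x_2 x_1` and `... y_2 y_1`: there is a sequence `g_k` in `G`
with finitely many values and `g_k (x_k ... x_1) = y_k ... y_1` for all `k`. -/
def AsymptoticallyEquivalent (G : Type v) {X : Type u} [Group G] [MulAction G (List X)]
    (ξ η : LeftWord X) : Prop :=
  ∃ g : ℕ → G, (Set.range g).Finite ∧ ∀ k, g k • ξ.last k = η.last k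

theorem asymptoticallyEquivalent_equivalence (G : Type v) (X : Type u) [Group G]
    [MulAction G (List X)] : Equivalence (AsymptoticallyEquivalent G (X := X)) where
  refl ξ := ⟨fun _ => 1, Set.finite_range_const, fun k => one_smul G _⟩
  symm := by
    rintro ξ η ⟨g, hg, h⟩
    refine ⟨fun k => (g k)⁻¹, ?_, fun k => by rw [← h k, inv_smul_smul]⟩
    have : (Set.range fun k => (g k)⁻¹) = (fun a => a⁻¹) '' Set.range g := by
      rw [← Set.range_comp]; rfl
    rw [this]
    exact hg.image _
  trans := by
    rintro ξ η ζ ⟨g, hg, h⟩ ⟨g', hg', h'⟩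
    refine ⟨fun k => g' k * g k, ?_, fun k => by rw [mul_smul, h k, h' k]⟩
    refine (Set.Finite.image2 (fun a b => a * b) hg' hg).subset ?_
    rintro _ ⟨k, rfl⟩
    exact ⟨g' k, ⟨k, rfl⟩, g k, ⟨k, rfl⟩, rfl⟩

/-- Asymptotic equivalence as a setoid. -/
def asymptoticSetoid (G : Type v) (X : Type u) [Group G] [MulAction G (List X)] :
    Setoid (LeftWord X) :=
  ⟨AsymptoticallyEquivalent G, asymptoticallyEquivalent_equivalence G X⟩

/-- The limit space of the action: left-infinite words modulo asymptotic equivalence. -/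
def LimitSpace (G : Type v) (X : Type u) [Group G] [MulAction G (List X)] : Type u :=
  Quotient (asymptoticSetoid G X)

/-- The quotient topology. -/
instance LimitSpace.instTopologicalSpace (G : Type v) (X : Type u) [Group G]
    [MulAction G (List X)] : TopologicalSpace (LimitSpace G X) :=
  inferInstanceAs (TopologicalSpace (Quotient (asymptoticSetoid G X)))

/-- The quotient map from left-infinite words to the limit space. -/
def LimitSpace.proj (G : Type v) (X : Type u) [Group G] [MulAction G (List X)] :
    LeftWord X → LimitSpace G X :=
  Quotient.mk (asymptoticSetoid G X)

/-! ### Self-similar structures -/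

/-- A self-similar structure on a compact metrizable space `K`: continuous injections
`F i : K → K` for `i : X`, for which there is a continuous surjection `π` from left-infinite words
to `K` with `F i ∘ π = π ∘ i`. The surjection `π` is determined by the maps `F i`, and it is
carried along. -/
structure SelfSimilarStructure (X : Type u) (K : Type w) [TopologicalSpace K] where
  compactSpace : CompactSpace K
  metrizableSpace : TopologicalSpace.MetrizableSpace K
  F : X → K → K
  continuous_F : ∀ i, Continuous (F i)
  injective_F : ∀ i, Function.Injective (F i)
  π : LeftWord X → K
  continuous_π : Continuous π
  surjective_π : Function.Surjective π
  F_π : ∀ (i : X) (ξ : LeftWord X), F i (π ξ) = π (ξ.snoc i)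

namespace SelfSimilarStructure

variable {X : Type u} {K : Type w} [TopologicalSpace K]

/-- `F_w = F_{x_1} ∘ F_{x_2} ∘ ... ∘ F_{x_n}` for `w = x_n ... x_2 x_1`. -/
def mapWord (L : SelfSimilarStructure X K) : List X → K → K
  | [] => id
  | x :: s => mapWord L s ∘ L.F x

/-- The cell `K_w = F_w(K)`. -/
def cell (L : SelfSimilarStructure X K) (s : List X) : Set K := Set.range (L.mapWord s)

/-- The critical set, the preimage under `π` of the union of all `K_i ∩ K_j` with `i ≠ j`. -/
def criticalSet (L : SelfSimilarStructure X K) : Set (LeftWord X) :=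
  L.π ⁻¹' ⋃ (i : X) (j : X) (_ : i ≠ j), L.cell [i] ∩ L.cell [j]

/-- The post-critical set, the union of the images of the critical set under the iterates
`σ^n`, `n ≥ 1`, of the shift. -/
def postCriticalSet (L : SelfSimilarStructure X K) : Set (LeftWord X) :=
  ⋃ (n : ℕ) (_ : 1 ≤ n), LeftWord.shift^[n] '' L.criticalSet

/-- Post-critically finite (p.c.f.): the post-critical set is finite. -/
def IsPCF (L : SelfSimilarStructure X K) : Prop := L.postCriticalSet.Finite

/-- Finitely ramified: any two distinct cells of the same level (cells of distinct words of the
same length) have finite intersection. -/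
def IsFinitelyRamified (L : SelfSimilarStructure X K) : Prop :=
  ∀ s t : List X, s.length = t.length → s ≠ t → (L.cell s ∩ L.cell t).Finite

/-- Isomorphism of self-similar structures: a bijection `ρ` of the alphabets such that
`π₂ ∘ ι_ρ ∘ π₁⁻¹` is a well-defined homeomorphism, where `ι_ρ` applies `ρ` letterwise. -/
def Isomorphic {Y : Type u'} {K' : Type w'} [TopologicalSpace K']
    (L : SelfSimilarStructure X K) (M : SelfSimilarStructure Y K') : Prop :=
  ∃ (ρ : X ≃ Y) (φ : K ≃ₜ K'), ∀ ξ : LeftWord X, φ (L.π ξ) = M.π (ξ.map ρ)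

end SelfSimilarStructure

end LimitSpaces

/-! For any structure with finite alphabet, p.c.f. implies finitely ramified: strip common last
letters from two words until cells of different letters meet, inside the finite set `π(C)`. For the
converse, contraction makes the fibres of `π` finite (`finite_asymptoticallyEquivalent`), so finite
ramification makes the critical set `C` finite. It remains to see that each critical `ξ` has a
finite shift orbit (`isPCF_of_finite_criticalSet`). Let `η ∼ ξ` have another last letter. Cutting
the equivalence at level `n` leaves a label `h n` in a finite set of restrictions. If `h n = h m`
with `m ≥ 1`, the left part cut at `n` can be glued to the last `m` letters, for `ξ` and `η` alike.
The glued words are equivalent with distinct last letters, so `C` contains `σⁿξ` followed by the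
last `m` letters of `ξ`. As `C` is finite, each label occurs with finitely many words `σⁿξ`. -/

namespace LimitSpaces

/-! ### Cutting and gluing left-infinite words -/

namespace LeftWord

variable {X : Type*} {Y : Type*}

/-- The left-infinite word obtained from `ζ` by writing the finite word `s` to its right. -/
def append (ζ : LeftWord X) : List X → LeftWord X
  | [] => ζ
  | x :: s => append (ζ.snoc x) s

theorem length_last (ξ : LeftWord X) (n : ℕ) : (ξ.last n).length = n := by
  induction n with
  | zero => rfl
  | succ n ih => simp [last, ih]

theorem last_eq_last_iff {ξ η : LeftWord X} {n : ℕ} :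
    ξ.last n = η.last n ↔ ∀ i < n, ξ i = η i := by
  induction n with
  | zero => simp [last]
  | succ n ih =>
    simp only [last, List.cons.injEq, ih]
    constructor
    · rintro ⟨h, h'⟩ i hi
      rcases Nat.lt_succ_iff_lt_or_eq.1 hi with hi | rfl
      exacts [h' i hi, h]
    · exact fun h => ⟨h n n.lt_succ_self, fun i hi => h i (hi.trans n.lt_succ_self)⟩

theorem last_add (ξ : LeftWord X) (n k : ℕ) :
    ξ.last (n + k) = LeftWord.last (shift^[n] ξ) k ++ ξ.last n := by
  induction k with
  | zero => rfl
  | succ k ih =>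
    have h : ∀ (n : ℕ) (ζ : LeftWord X), (shift^[n] ζ) k = ζ (n + k) := by
      intro n
      induction n with
      | zero => simp
      | succ n ihn =>
        intro ζ
        rw [Function.iterate_succ_apply, ihn]
        exact congrArg ζ (by omega)
    change ξ (n + k) :: ξ.last (n + k) = (shift^[n] ξ) k :: (LeftWord.last (shift^[n] ξ) k ++ _)
    rw [ih, h]

theorem snoc_shift (ξ : LeftWord X) : snoc (ξ 0) (shift ξ) = ξ := by
  funext n
  cases n <;> rfl

theorem shift_snoc (x : X) (ξ : LeftWord X) : shift (snoc x ξ) = ξ := rfl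

theorem shift_iterate_append (ζ : LeftWord X) (s : List X) :
    shift^[s.length] (ζ.append s) = ζ := by
  induction s generalizing ζ with
  | nil => rfl
  | cons x s ih =>
    rw [List.length_cons, Function.iterate_succ_apply', append, ih, shift_snoc]

theorem append_injective (s : List X) : Function.Injective fun ζ : LeftWord X => ζ.append s :=
  Function.LeftInverse.injective fun ζ => shift_iterate_append ζ s

theorem append_shift_iterate (ξ : LeftWord X) (n : ℕ) :
    append (shift^[n] ξ) (ξ.last n) = ξ := by
  induction n with
  | zero => rfl
  | succ n ih =>
    have h : ξ n = (shift^[n] ξ) 0 := by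
      have := last_add ξ n 1
      simp only [last, List.cons_append, List.nil_append, List.cons.injEq] at this
      exact this.1
    rw [last, append, Function.iterate_succ_apply', h, snoc_shift, ih]

theorem last_append (ζ : LeftWord X) (s : List X) : (ζ.append s).last s.length = s := by
  -- The extra `k` letters feed the induction: the letter moved into `ζ` by `append` is read off
  -- with `k + 1` in place of `k`.
  have h : ∀ (s : List X) (ζ : LeftWord X) (k : ℕ),
      (ζ.append s).last (s.length + k) = ζ.last k ++ s := by
    intro s
    induction s with
    | nil => intro ζ k; simp [append]
    | cons x s ih =>
      intro ζ k
      have := last_add (ζ.snoc x) 1 k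
      rw [append, List.length_cons, Nat.add_assoc, ih, this]
      simp [last, snoc, shift_snoc]
  simpa [last] using h s ζ 0

theorem map_injective {ρ : X → Y} (hρ : Function.Injective ρ) :
    Function.Injective (LeftWord.map ρ) :=
  fun _ _ h => funext fun n => hρ (congrFun h n)

theorem last_map (ρ : X → Y) (ξ : LeftWord X) (n : ℕ) :
    (ξ.map ρ).last n = (ξ.last n).map ρ := by
  induction n with
  | zero => rfl
  | succ n ih => rw [last, last, List.map_cons, ih]; rfl

theorem map_surjective (ρ : X ≃ Y) : Function.Surjective (LeftWord.map ρ) :=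
  fun η => ⟨η.map ρ.symm, funext fun n => ρ.apply_symm_apply (η n)⟩

theorem shift_iterate_map (ρ : X → Y) (ξ : LeftWord X) (n : ℕ) :
    shift^[n] (ξ.map ρ) = LeftWord.map ρ (shift^[n] ξ) :=
  ((Function.Semiconj.iterate_right (f := LeftWord.map ρ) (ga := shift) (gb := shift)
    (fun _ => rfl) n).eq ξ).symm

end LeftWord

/-! ### Cells, critical sets and isomorphisms -/

namespace SelfSimilarStructure

variable {X : Type*} {K : Type*} [TopologicalSpace K] (L : SelfSimilarStructure X K)

theorem mapWord_π (s : List X) (ζ : LeftWord X) : L.mapWord s (L.π ζ) = L.π (ζ.append s) := by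
  induction s generalizing ζ with
  | nil => rfl
  | cons x s ih => rw [mapWord, Function.comp_apply, L.F_π, ih, LeftWord.append]

theorem mem_cell_iff {s : List X} {z : K} :
    z ∈ L.cell s ↔ ∃ ξ : LeftWord X, ξ.last s.length = s ∧ L.π ξ = z := by
  constructor
  · rintro ⟨y, rfl⟩
    obtain ⟨ζ, rfl⟩ := L.surjective_π y
    exact ⟨ζ.append s, LeftWord.last_append ζ s, (L.mapWord_π s ζ).symm⟩
  · rintro ⟨ξ, hs, rfl⟩
    refine ⟨L.π (LeftWord.shift^[s.length] ξ), ?_⟩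
    rw [mapWord_π]
    conv_lhs => rw [← hs, LeftWord.length_last]
    rw [LeftWord.append_shift_iterate]

/-- A last letter cannot equal both of two distinct letters `i`, `j`, so a point of `K_i ∩ K_j`
always has a representative ending differently from `ξ`. -/
theorem mem_criticalSet_iff {ξ : LeftWord X} :
    ξ ∈ L.criticalSet ↔ ∃ η : LeftWord X, L.π ξ = L.π η ∧ ξ 0 ≠ η 0 := by
  have hc : ∀ i z, z ∈ L.cell [i] ↔ ∃ ξ : LeftWord X, ξ 0 = i ∧ L.π ξ = z := by
    intro i z
    simp [mem_cell_iff, LeftWord.last]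
  simp only [criticalSet, Set.mem_preimage, Set.mem_iUnion, Set.mem_inter_iff, hc]
  constructor
  · rintro ⟨i, j, hij, ⟨η, rfl, hη⟩, ⟨ζ, rfl, hζ⟩⟩
    by_cases h : ξ 0 = η 0
    · exact ⟨ζ, hζ.symm, h ▸ hij⟩
    · exact ⟨η, hη.symm, h⟩
  · rintro ⟨η, h, hne⟩
    exact ⟨_, _, hne, ⟨ξ, rfl, rfl⟩, ⟨η, rfl, h.symm⟩⟩

theorem mapWord_append_singleton (s : List X) (x : X) :
    L.mapWord (s ++ [x]) = L.F x ∘ L.mapWord s := by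
  induction s with
  | nil => rfl
  | cons y s ih => rw [List.cons_append, mapWord, ih, mapWord, Function.comp_assoc]

theorem cell_append_singleton (s : List X) (x : X) : L.cell (s ++ [x]) = L.F x '' L.cell s := by
  rw [cell, mapWord_append_singleton, Set.range_comp, cell]

variable {L} in
-- A critical word is its shift, which is post-critical, followed by one of finitely many letters.
theorem IsPCF.finite_criticalSet [Finite X] (h : L.IsPCF) : L.criticalSet.Finite := by
  refine (Set.finite_iUnion fun x : X => h.image (LeftWord.snoc x)).subset fun ξ hξ => ?_
  refine Set.mem_iUnion.2 ⟨ξ 0, LeftWord.shift ξ, ?_, LeftWord.snoc_shift ξ⟩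
  exact Set.mem_iUnion₂.2 ⟨1, le_rfl, ξ, hξ, rfl⟩

variable {L} in
/-- Every p.c.f. self-similar structure with a finite alphabet is finitely ramified. -/
theorem IsPCF.isFinitelyRamified [Finite X] (h : L.IsPCF) : L.IsFinitelyRamified := by
  intro s
  induction s using List.reverseRecOn with
  | nil =>
    intro t ht hne
    exact absurd (List.length_eq_zero_iff.1 ht.symm).symm hne
  | append_singleton s x ih =>
    intro t ht hne
    rcases List.eq_nil_or_concat t with rfl | ⟨t, y, rfl⟩
    · simp at ht
    simp only [List.concat_eq_append] at *
    rw [cell_append_singleton, cell_append_singleton]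
    -- The last letter indexes the outermost map: a common one is removed by injectivity of `F x`,
    -- and distinct ones place the intersection in `π(C)`.
    by_cases hxy : x = y
    · subst hxy
      rw [← Set.image_inter (L.injective_F x)]
      exact (ih t (by simpa using ht) fun e => hne (by rw [e])).image _
    · refine (h.finite_criticalSet.image L.π).subset ?_
      rintro z ⟨⟨a, -, rfl⟩, ⟨b, -, hb⟩⟩
      obtain ⟨ξ, rfl⟩ := L.surjective_π a
      obtain ⟨η, rfl⟩ := L.surjective_π b
      rw [L.F_π, L.F_π] at hb
      exact ⟨ξ.snoc x, L.mem_criticalSet_iff.2 ⟨η.snoc y, hb.symm, hxy⟩, (L.F_π x ξ).symm⟩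

section Isomorphic

variable {L} {Y : Type*} {K' : Type*} [TopologicalSpace K'] {M : SelfSimilarStructure Y K'}

theorem Isomorphic.isFinitelyRamified (h : L.Isomorphic M) (hL : L.IsFinitelyRamified) :
    M.IsFinitelyRamified := by
  obtain ⟨ρ, φ, hφ⟩ := h
  have hcell : ∀ s, φ '' L.cell s = M.cell (s.map ρ) := by
    intro s
    ext z
    simp only [Set.mem_image, mem_cell_iff]
    constructor
    · rintro ⟨_, ⟨ξ, hs, rfl⟩, rfl⟩
      exact ⟨ξ.map ρ, by rw [List.length_map, LeftWord.last_map, hs], (hφ ξ).symm⟩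
    · rintro ⟨η, hs, rfl⟩
      obtain ⟨ξ, rfl⟩ := LeftWord.map_surjective ρ η
      rw [List.length_map, LeftWord.last_map] at hs
      exact ⟨_, ⟨ξ, List.map_injective_iff.2 ρ.injective hs, rfl⟩, hφ ξ⟩
  intro s t hst hne
  obtain ⟨s, rfl⟩ := List.map_surjective_iff.2 ρ.surjective s
  obtain ⟨t, rfl⟩ := List.map_surjective_iff.2 ρ.surjective t
  rw [← hcell, ← hcell, ← Set.image_inter φ.injective]
  exact (hL s t (by simpa using hst) fun e => hne (by rw [e])).image _

theorem Isomorphic.isPCF (h : L.Isomorphic M) (hM : M.IsPCF) : L.IsPCF := by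
  obtain ⟨ρ, φ, hφ⟩ := h
  refine Set.Finite.of_injOn (f := LeftWord.map ρ) ?_
    (LeftWord.map_injective ρ.injective).injOn hM
  intro ζ hζ
  obtain ⟨n, hn, ξ, hξ, rfl⟩ := Set.mem_iUnion₂.1 hζ
  obtain ⟨η, hη, hne⟩ := L.mem_criticalSet_iff.1 hξ
  refine Set.mem_iUnion₂.2 ⟨n, hn, ξ.map ρ, M.mem_criticalSet_iff.2 ⟨η.map ρ, ?_, ?_⟩,
    LeftWord.shift_iterate_map ρ ξ n⟩
  · rw [← hφ, ← hφ, hη]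
  · exact fun e => hne (ρ.injective e)

end Isomorphic

end SelfSimilarStructure

/-! ### Restrictions and contraction -/

section Action

variable {G : Type*} {X : Type*} [Group G] [MulAction G (List X)]

namespace IsSelfSimilarAction

theorem length_smul (hG : IsSelfSimilarAction G X) (g : G) (s : List X) :
    (g • s).length = s.length := by
  induction s generalizing g with
  | nil => rw [hG.smul_root]
  | cons x s ih =>
    obtain ⟨h, y, hy⟩ := hG.stateClosed g x
    rw [hy, List.length_cons, ih, List.length_cons]

theorem exists_isRestriction (hG : IsSelfSimilarAction G X) (g : G) (s : List X) :
    ∃ h : G, IsRestriction g s h := by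
  induction s generalizing g with
  | nil => exact ⟨g, fun w => by rw [hG.smul_root]; rfl⟩
  | cons x s ih =>
    obtain ⟨h, y, hy⟩ := hG.stateClosed g x
    obtain ⟨h', hh'⟩ := ih h
    exact ⟨h', fun w => by rw [List.cons_append, hy, hh', hy, List.cons_append]⟩

theorem isRestriction_unique (hG : IsSelfSimilarAction G X) {g h h' : G} {s : List X}
    (hh : IsRestriction g s h) (hh' : IsRestriction g s h') : h = h' :=
  hG.faithful.eq_of_smul_eq_smul fun w =>
    List.append_cancel_left ((hh w).symm.trans (hh' w))

/-- If `g (s t) = s' t'` with `|s| = |s'|`, then `g (s) = s'` and `g|_s (t) = t'`. -/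
theorem smul_eq_of_smul_append (hG : IsSelfSimilarAction G X) {g h : G} {s s' t t' : List X}
    (hh : IsRestriction g s h) (hl : s.length = s'.length) (e : g • (s ++ t) = s' ++ t') :
    g • s = s' ∧ h • t = t' :=
  List.append_inj ((hh t).symm.trans e) (by rw [hG.length_smul, hl])

end IsSelfSimilarAction

/-- The restriction of `g` at `s t` is the restriction at `t` of the restriction at `s`. -/
theorem IsRestriction.of_append {g h h' : G} {s t : List X} (hs : IsRestriction g s h)
    (ht : IsRestriction h t h') : IsRestriction g (s ++ t) h' := fun w => by
  rw [List.append_assoc, hs, ht, hs, List.append_assoc]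

/-- The set of all restrictions of elements of `S`. -/
def restrictions (X : Type*) [MulAction G (List X)] (S : Set G) : Set G :=
  {h | ∃ g ∈ S, ∃ s : List X, IsRestriction g s h}

namespace IsContractingAction

/-- Restrictions of a given element at long words lie in the nucleus-like set `N`, and only finitely
many words are short. -/
theorem finite_restrictions [Finite X] (hG : IsContractingAction G X) {S : Set G}
    (hS : S.Finite) : (restrictions X S).Finite := by
  obtain ⟨N, hN, hc⟩ := hG.contracting
  have key : ∀ g : G, {h | ∃ s : List X, IsRestriction g s h}.Finite := by
    intro g
    obtain ⟨k, hk⟩ := hc g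
    choose r hr using hG.exists_isRestriction g
    refine (hN.union ((List.finite_length_lt X k).image r)).subset ?_
    rintro h ⟨s, hs⟩
    rcases lt_or_ge s.length k with hlt | hge
    · exact Or.inr ⟨s, hlt, hG.isRestriction_unique (hr s) hs⟩
    · obtain ⟨h', hh', hs'⟩ := hk s hge
      rw [hG.isRestriction_unique hs hs']
      exact Or.inl hh'
  refine (hS.biUnion fun g _ => key g).subset ?_
  rintro h ⟨g, hg, s, hs⟩
  exact Set.mem_biUnion hg ⟨s, hs⟩

/-- The elements realizing an asymptotic equivalence can be taken in a finite set that does not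
depend on the words. -/
theorem exists_finite_forall_asymptoticallyEquivalent (hG : IsContractingAction G X) :
    ∃ N : Set G, N.Finite ∧ ∀ ξ η : LeftWord X, AsymptoticallyEquivalent G ξ η →
      ∀ n, ∃ h ∈ N, h • ξ.last n = η.last n := by
  obtain ⟨N, hN, hc⟩ := hG.contracting
  refine ⟨N, hN, ?_⟩
  rintro ξ η ⟨g, hg, hξη⟩ n
  choose k hk using hc
  -- As `g` has finitely many values, one depth `B` serves them all: restricting `g (n + B)` at the
  -- leftmost `B` of the last `n + B` letters lands in `N`.
  obtain ⟨B, hB⟩ := (hg.image k).bddAbove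
  have hB' : k (g (n + B)) ≤ B := hB ⟨_, ⟨_, rfl⟩, rfl⟩
  obtain ⟨h, hhN, hh⟩ := hk (g (n + B)) (LeftWord.last (LeftWord.shift^[n] ξ) B)
    (by rwa [LeftWord.length_last])
  have e := hξη (n + B)
  rw [LeftWord.last_add, LeftWord.last_add η] at e
  exact ⟨h, hhN, (hG.smul_eq_of_smul_append hh (by simp only [LeftWord.length_last]) e).2⟩

/-- Asymptotic equivalence classes are finite. -/
theorem finite_asymptoticallyEquivalent (hG : IsContractingAction G X) (ξ : LeftWord X) :
    {η | AsymptoticallyEquivalent G ξ η}.Finite := by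
  obtain ⟨N, hN, hc⟩ := hG.exists_finite_forall_asymptoticallyEquivalent
  -- A free ultrafilter selects for each `η` a single `h ∈ N` valid at almost all levels. Two words
  -- with the same `h` then agree at arbitrarily high levels, so `η ↦ h` is injective.
  have key : ∀ η, AsymptoticallyEquivalent G ξ η →
      ∃ h ∈ N, ∀ᶠ n in (Filter.hyperfilter ℕ : Filter ℕ), h • ξ.last n = η.last n := by
    intro η hη
    have : (⋃ h ∈ N, {n | h • ξ.last n = η.last n}) ∈ Filter.hyperfilter ℕ := by
      refine Filter.mem_of_superset (Filter.univ_mem (f := (Filter.hyperfilter ℕ : Filter ℕ)))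
        fun n _ => ?_
      simpa using hc ξ η hη n
    exact (Ultrafilter.finite_biUnion_mem_iff hN).1 this
  choose! h hhN hh using key
  refine Set.Finite.of_injOn (f := h) (fun η hη => hhN η hη) ?_ hN
  intro η hη ζ hζ e
  have e₁ := hh η hη
  have e₂ := hh ζ hζ
  rw [← e] at e₂
  funext i
  have hi : ∀ᶠ n in (Filter.hyperfilter ℕ : Filter ℕ), i < n :=
    (Filter.eventually_gt_atTop i).filter_mono Nat.hyperfilter_le_atTop
  obtain ⟨n, ⟨h₁, h₂⟩, hn⟩ := ((e₁.and e₂).and hi).exists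
  exact LeftWord.last_eq_last_iff.1 (h₁.symm.trans h₂) i hn

/-- An asymptotic equivalence of `ξ` and `η` cuts at level `n` into an asymptotic equivalence
of the shifted words through elements with a common restriction `h`, and the element `h`, which
moves the last `n` letters of `ξ` to those of `η`. -/
theorem exists_restriction_of_asymptoticallyEquivalent [Finite X] (hG : IsContractingAction G X)
    {ξ η : LeftWord X} {g : ℕ → G} (hg : (Set.range g).Finite)
    (hξη : ∀ k, g k • ξ.last k = η.last k) (n : ℕ) :
    ∃ h ∈ restrictions X (Set.range g), h • ξ.last n = η.last n ∧
      ∀ k, ∃ a ∈ restrictions X (Set.range g),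
        a • LeftWord.last (LeftWord.shift^[n] ξ) k = LeftWord.last (LeftWord.shift^[n] η) k ∧
        IsRestriction a (LeftWord.last (LeftWord.shift^[n] ξ) k) h := by
  choose c hc using fun k =>
    hG.exists_isRestriction (g (n + k)) (LeftWord.last (LeftWord.shift^[n] ξ) k)
  have hcR : ∀ k, c k ∈ restrictions X (Set.range g) := fun k => ⟨_, ⟨_, rfl⟩, _, hc k⟩
  -- Pigeonhole: the restrictions `c k` take finitely many values, so one recurs for infinitely many
  -- `k`.
  obtain ⟨h, hhR, hinf⟩ : ∃ h ∈ restrictions X (Set.range g), {k | c k = h}.Infinite := by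
    by_contra! hfin
    refine Set.infinite_univ (α := ℕ) (((hG.finite_restrictions hg).biUnion
      hfin).subset fun k _ => ?_)
    exact Set.mem_biUnion (hcR k) rfl
  have hsplit : ∀ k, g (n + k) • LeftWord.last (LeftWord.shift^[n] ξ) k =
      LeftWord.last (LeftWord.shift^[n] η) k ∧ c k • ξ.last n = η.last n := by
    intro k
    have e := hξη (n + k)
    rw [LeftWord.last_add, LeftWord.last_add η] at e
    exact hG.smul_eq_of_smul_append (hc k) (by simp only [LeftWord.length_last]) e
  refine ⟨h, hhR, ?_, fun k => ?_⟩
  · obtain ⟨k, rfl⟩ := hinf.nonempty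
    exact (hsplit k).2
  · obtain ⟨m, rfl, hm⟩ := hinf.exists_gt k
    obtain ⟨d, rfl⟩ := Nat.exists_eq_add_of_lt hm
    rw [Nat.add_assoc] at *
    have hcm := hc (k + (d + 1))
    have e := (hsplit (k + (d + 1))).1
    rw [LeftWord.last_add] at hcm
    rw [LeftWord.last_add, LeftWord.last_add (LeftWord.shift^[n] η)] at e
    obtain ⟨a, ha⟩ := hG.exists_isRestriction (g (n + (k + (d + 1))))
      (LeftWord.last (LeftWord.shift^[k] (LeftWord.shift^[n] ξ)) (d + 1))
    obtain ⟨b, hb⟩ := hG.exists_isRestriction a (LeftWord.last (LeftWord.shift^[n] ξ) k)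
    rw [← hG.isRestriction_unique (ha.of_append hb) hcm]
    exact ⟨a, ⟨_, ⟨_, rfl⟩, _, ha⟩,
      (hG.smul_eq_of_smul_append ha (by simp only [LeftWord.length_last]) e).2, hb⟩

theorem isPCF_of_finite_criticalSet [Finite X] (hG : IsContractingAction G X)
    (L : SelfSimilarStructure X (LimitSpace G X)) (hL : L.π = LimitSpace.proj G X)
    (hC : L.criticalSet.Finite) : L.IsPCF := by
  have hproj : ∀ ξ η, L.π ξ = L.π η ↔ AsymptoticallyEquivalent G ξ η := by
    intro ξ η
    rw [hL]
    exact Quotient.eq (r := asymptoticSetoid G X)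
  have horbit : ∀ ξ ∈ L.criticalSet, (Set.range fun n => LeftWord.shift^[n] ξ).Finite := by
    intro ξ hξ
    obtain ⟨η, hη, hne⟩ := L.mem_criticalSet_iff.1 hξ
    obtain ⟨g, hg, hξη⟩ := (hproj ξ η).1 hη
    have hR := hG.finite_restrictions hg
    choose h hhR hh ha using hG.exists_restriction_of_asymptoticallyEquivalent hg hξη
    have hcrit : ∀ m n, 1 ≤ m → h n = h m →
        LeftWord.append (LeftWord.shift^[n] ξ) (ξ.last m) ∈ L.criticalSet := by
      intro m n hm hnm
      have hlast : ∀ ζ θ : LeftWord X, LeftWord.last (ζ.append (θ.last m)) m = θ.last m := by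
        intro ζ θ
        conv_lhs => rw [← LeftWord.length_last θ m]
        rw [LeftWord.length_last θ m]
        simpa only [LeftWord.length_last] using LeftWord.last_append ζ (θ.last m)
      have hshift : ∀ ζ θ : LeftWord X, LeftWord.shift^[m] (ζ.append (θ.last m)) = ζ := by
        intro ζ θ
        simpa only [LeftWord.length_last] using LeftWord.shift_iterate_append ζ (θ.last m)
      refine L.mem_criticalSet_iff.2
        ⟨LeftWord.append (LeftWord.shift^[n] η) (η.last m), (hproj _ _).2 ?_, ?_⟩
      · have : ∀ j, ∃ a ∈ Set.range g ∪ restrictions X (Set.range g),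
            a • LeftWord.last (LeftWord.append (LeftWord.shift^[n] ξ) (ξ.last m)) j =
              LeftWord.last (LeftWord.append (LeftWord.shift^[n] η) (η.last m)) j := by
          intro j
          rcases le_total j m with hj | hj
          · have hsmall : ∀ ζ θ : LeftWord X,
                LeftWord.last (ζ.append (θ.last m)) j = θ.last j := fun ζ θ =>
              LeftWord.last_eq_last_iff.2 fun i hi =>
                LeftWord.last_eq_last_iff.1 (hlast ζ θ) i (hi.trans_le hj)
            rw [hsmall, hsmall]
            exact ⟨g j, Or.inl ⟨j, rfl⟩, hξη j⟩
          · obtain ⟨k, rfl⟩ := Nat.exists_eq_add_of_le hj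
            obtain ⟨a, haR, hak, har⟩ := ha n k
            refine ⟨a, Or.inr haR, ?_⟩
            rw [LeftWord.last_add, LeftWord.last_add (LeftWord.append _ (η.last m)), hlast, hlast,
              hshift, hshift, har, hak, hnm, hh]
        choose a haR hak using this
        exact ⟨a, (hg.union hR).subset (Set.range_subset_iff.2 haR), hak⟩
      -- Since `m ≥ 1`, the glued words keep the distinct last letters of `ξ` and `η`.
      · rwa [LeftWord.last_eq_last_iff.1 (hlast _ ξ) 0 hm,
          LeftWord.last_eq_last_iff.1 (hlast _ η) 0 hm]
    have hfin : ∀ r : G, {ζ | ∃ n, 1 ≤ n ∧ h n = r ∧ LeftWord.shift^[n] ξ = ζ}.Finite := by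
      intro r
      by_cases hr : ∃ m, 1 ≤ m ∧ h m = r
      · obtain ⟨m, hm, rfl⟩ := hr
        -- With `m` fixed, gluing on the last `m` letters of `ξ` embeds all shifts labelled `h m`
        -- into `C`.
        refine Set.Finite.of_injOn ?_ (LeftWord.append_injective (ξ.last m)).injOn hC
        rintro _ ⟨n, -, hnm, rfl⟩
        exact hcrit m n hm hnm
      · convert Set.finite_empty
        refine Set.eq_empty_of_forall_notMem ?_
        rintro _ ⟨n, hn, hnr, -⟩
        exact hr ⟨n, hn, hnr⟩
    refine ((Set.finite_singleton ξ).union (hR.biUnion fun r _ => hfin r)).subset ?_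
    rintro _ ⟨n, rfl⟩
    rcases Nat.eq_zero_or_pos n with rfl | hn
    · exact Or.inl rfl
    · exact Or.inr (Set.mem_biUnion (hhR n) ⟨n, hn, rfl, rfl⟩)
  refine (hC.biUnion horbit).subset fun ζ hζ => ?_
  obtain ⟨n, -, ξ, hξ, rfl⟩ := Set.mem_iUnion₂.1 hζ
  exact Set.mem_biUnion hξ ⟨n, rfl⟩

theorem isPCF_iff_isFinitelyRamified [Finite X] (hG : IsContractingAction G X)
    (L : SelfSimilarStructure X (LimitSpace G X)) (hL : L.π = LimitSpace.proj G X) :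
    L.IsPCF ↔ L.IsFinitelyRamified := by
  refine ⟨fun h => h.isFinitelyRamified, fun h => hG.isPCF_of_finite_criticalSet L hL ?_⟩
  -- `C` is the preimage of a finite union of finite intersections, and each fibre of `π` lies in
  -- one asymptotic class.
  refine Set.Finite.preimage' ?_ fun z _ => ?_
  · exact Set.finite_iUnion fun i => Set.finite_iUnion fun j => Set.finite_iUnion fun hij =>
      h [i] [j] rfl (by simpa using hij)
  · obtain ⟨ξ, rfl⟩ := L.surjective_π z
    refine (hG.finite_asymptoticallyEquivalent ξ).subset fun η hη => ?_
    rw [hL] at hη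
    exact Quotient.exact (s := asymptoticSetoid G X) (Eq.symm hη)

end IsContractingAction

end Action

end LimitSpaces

theorem mainTheorem8
    {X : Type*} [Finite X] {G : Type*} [Group G] [MulAction G (List X)]
    (hG : LimitSpaces.IsContractingAction G X)
    (L : LimitSpaces.SelfSimilarStructure X (LimitSpaces.LimitSpace G X))
    (hL : L.π = LimitSpaces.LimitSpace.proj G X) :
    (L.IsPCF ↔ L.IsFinitelyRamified) ∧
    (∀ {Y : Type*} [Finite Y] {K : Type*} [TopologicalSpace K]
      (M : LimitSpaces.SelfSimilarStructure Y K),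
      M.IsFinitelyRamified → ¬ M.IsPCF → ¬ M.Isomorphic L) := by
  have key := hG.isPCF_iff_isFinitelyRamified L hL
  -- An isomorphism would carry finite ramification from `M` to `L`, and then p.c.f. back from `L`
  -- to `M`.
  exact ⟨key, fun M hM hM' e => hM' (e.isPCF (key.2 (e.isFinitelyRamified hM)))⟩
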